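/- Let $A\in\mathbb{R}^{N\times N}$, $B\in\mathbb{R}^{N\times M}$, and let $Q\in\mathbb{R}^{N\times N}$, $R\in\mathbb{R}^{M\times M}$ be symmetric positive definite. Assume that $(A,B)$ is stabilizable, i.e. there is $K\in\mathbb{R}^{M\times N}$ such that all eigenvalues of $A-BK$ have modulus less than $1$. Write $\|\cdot\|$ for the spectral norm and, for positive definite $X,Y$, let $\delta(X,Y)=\|\log(Y^{-1/2}XY^{-1/2})\|_{\mathrm F}$ (called the Thomson distance), where $\|\cdot\|_{\mathrm F}$ is the Frobenius norm. Then the discrete algebraic Riccati equation $$P=A^\top PA+Q-A^\top PB\,[R+B^\top PB]^{-1}B^\top PA$$ has a unique positive definite solution $P$. Moreover, for every positive definite $P_0$, the recursion $$P_{k+1}=A^\top P_kA+Q-A^\top P_kB\,[R+B^\top P_kB]^{-1}B^\top P_kA$$ is well defined with every $P_k$ positive definite, $\lim_{k\to\infty}P_k=P$, and for all $k\ge 0$ $$\|P-P_k\|\le\left(e^{\rho^k\delta(P,P_0)}-1\right)\|P\|,\qquad \rho=\frac{1}{1+\left(\|Q^{-1}\|\,\|A\|^2\,\|P\|\right)^{-1}e^{-\delta(P,P_0)}}<1,$$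 where for $A=0$ the expression for $\rho$ is read as its limiting value $\rho=0$ (and $0^0=1$). -/

import Mathlib

open Matrix Filter Topology

noncomputable section

/-- The spectral norm of a square real matrix (operator norm for the Euclidean norm). -/
def matSpectralNorm {N : ℕ} (M : Matrix (Fin N) (Fin N) ℝ) : ℝ :=
  ‖Matrix.toEuclideanCLM (n := Fin N) (𝕜 := ℝ) M‖

/-- The Frobenius norm of a square real matrix. -/
def frobNorm {N : ℕ} (M : Matrix (Fin N) (Fin N) ℝ) : ℝ :=
  Real.sqrt (∑ i, ∑ j, M i j ^ 2)

/-- The inverse of the positive definite square root of a positive definite matrix. -/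
def invSqrt {N : ℕ} (Q : Matrix (Fin N) (Fin N) ℝ) : Matrix (Fin N) (Fin N) ℝ :=
  (cfc Real.sqrt Q)⁻¹

/-- The distance `‖log (Q^{-1/2} P Q^{-1/2})‖_F` between positive definite matrices; the square
root and the logarithm are taken through the functional calculus of symmetric matrices. -/
def thomsonDist {N : ℕ} (P Q : Matrix (Fin N) (Fin N) ℝ) : ℝ :=
  frobNorm (cfc Real.log (invSqrt Q * P * invSqrt Q))

/-- All complex eigenvalues lie in the open unit disc. -/
def IsSchurStable {N : ℕ} (M : Matrix (Fin N) (Fin N) ℝ) : Prop :=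
  ∀ z ∈ spectrum ℂ (M.map (algebraMap ℝ ℂ)), ‖z‖ < 1

/-- Discrete-time stabilizability of the pair `(A, B)`: some linear state feedback `u = - K x`
makes the closed loop `A - B K` stable. -/
def IsStabilizable {N M : ℕ} (A : Matrix (Fin N) (Fin N) ℝ) (B : Matrix (Fin N) (Fin M) ℝ) :
    Prop :=
  ∃ K : Matrix (Fin M) (Fin N) ℝ, IsSchurStable (A - B * K)

/-- The right-hand side of the discrete algebraic Riccati equation. -/
def riccatiMap {N M : ℕ} (A : Matrix (Fin N) (Fin N) ℝ) (B : Matrix (Fin N) (Fin M) ℝ)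
    (Q : Matrix (Fin N) (Fin N) ℝ) (R : Matrix (Fin M) (Fin M) ℝ)
    (P : Matrix (Fin N) (Fin N) ℝ) : Matrix (Fin N) (Fin N) ℝ :=
  Aᵀ * P * A + Q - Aᵀ * P * B * (R + Bᵀ * P * B)⁻¹ * Bᵀ * P * A

open Classical in
/-- The contraction rate `ρ`. For `A = 0` the formula contains the reciprocal of `0`, and `ρ` is
its limiting value `0`. -/
def riccatiRate {N : ℕ} (A Q P P₀ : Matrix (Fin N) (Fin N) ℝ) : ℝ :=
  if A = 0 then 0
  else 1 / (1 + (matSpectralNorm Q⁻¹ * matSpectralNorm A ^ 2 * matSpectralNorm P)⁻¹ *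
    Real.exp (-thomsonDist P P₀))

end

/-! Completing the square shows that the Riccati map `F` is the minimum over gains `K` of
`feedbackCost`, which is monotone and affine in the cost matrix (`feedbackCost_eq_riccatiMap_add`).
Hence `F` is monotone, and `F - Q` is subhomogeneous under scalings `t ≥ 1`. At a fixed point, `P -
Q ≤ Aᵀ P A ≤ γ Q` with `γ = ‖Q⁻¹‖ ‖A‖² ‖P‖`, so the unscaled term `Q` is a definite share of `P`.
Therefore `F` shrinks an order interval `[e^{-d} P, e^d P]` to one with exponent `ρ d`
(`riccatiMap_contraction`).

Iterating gives the rate and convergence, and uniqueness follows because another solution is a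
constant orbit. Existence is by monotone iteration from `0`, bounded above by the cost of a
stabilizing feedback (`exists_posDef_eq_riccatiMap`). -/

section Auxiliary

open scoped MatrixOrder

/-- The one-step cost matrix of the feedback `u = - K x` with terminal cost `P`. -/
def feedbackCost {N M : ℕ} (A : Matrix (Fin N) (Fin N) ℝ) (B : Matrix (Fin N) (Fin M) ℝ)
    (Q : Matrix (Fin N) (Fin N) ℝ) (R : Matrix (Fin M) (Fin M) ℝ)
    (P : Matrix (Fin N) (Fin N) ℝ) (K : Matrix (Fin M) (Fin N) ℝ) : Matrix (Fin N) (Fin N) ℝ :=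
  (A - B * K)ᵀ * P * (A - B * K) + Q + Kᵀ * R * K

/-- The optimal feedback gain for the terminal cost `P`. -/
noncomputable def optimalGain {N M : ℕ} (A : Matrix (Fin N) (Fin N) ℝ)
    (B : Matrix (Fin N) (Fin M) ℝ) (R : Matrix (Fin M) (Fin M) ℝ) (P : Matrix (Fin N) (Fin N) ℝ) :
    Matrix (Fin M) (Fin N) ℝ :=
  (R + Bᵀ * P * B)⁻¹ * Bᵀ * P * A

theorem posSemidef_transpose_mul_mul {m n : ℕ} {X : Matrix (Fin n) (Fin n) ℝ} (hX : X.PosSemidef)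
    (C : Matrix (Fin n) (Fin m) ℝ) : (Cᵀ * X * C).PosSemidef := by
  simpa [conjTranspose_eq_transpose_of_trivial] using hX.conjTranspose_mul_mul_same C

theorem transpose_mul_mul_mono {m n : ℕ} {X Y : Matrix (Fin n) (Fin n) ℝ} (h : X ≤ Y)
    (C : Matrix (Fin n) (Fin m) ℝ) : Cᵀ * X * C ≤ Cᵀ * Y * C := by
  rw [Matrix.le_iff] at h ⊢
  simpa [Matrix.mul_sub, Matrix.sub_mul] using posSemidef_transpose_mul_mul h C

/-! ### Order properties of the Riccati map. -/

section Riccati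

variable {N M : ℕ} (A : Matrix (Fin N) (Fin N) ℝ) (B : Matrix (Fin N) (Fin M) ℝ)
    (Q : Matrix (Fin N) (Fin N) ℝ) {R : Matrix (Fin M) (Fin M) ℝ}
    {P P' : Matrix (Fin N) (Fin N) ℝ}

theorem posDef_add_transpose_mul_mul (hR : R.PosDef) (hP : P.PosSemidef) :
    (R + Bᵀ * P * B).PosDef :=
  hR.add_posSemidef (posSemidef_transpose_mul_mul hP B)

theorem feedbackCost_eq_riccatiMap_add (hR : R.PosDef) (hP : P.PosSemidef)
    (K : Matrix (Fin M) (Fin N) ℝ) :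
    feedbackCost A B Q R P K = riccatiMap A B Q R P +
      (K - optimalGain A B R P)ᵀ * (R + Bᵀ * P * B) * (K - optimalGain A B R P) := by
  have hW := posDef_add_transpose_mul_mul B hR hP
  have hPt : Pᵀ = P := (conjTranspose_eq_transpose_of_trivial P).symm.trans hP.isHermitian
  have hWt : (R + Bᵀ * P * B)ᵀ = R + Bᵀ * P * B :=
    (conjTranspose_eq_transpose_of_trivial _).symm.trans hW.isHermitian
  have hdet : IsUnit (R + Bᵀ * P * B).det := (Matrix.isUnit_iff_isUnit_det _).1 hW.isUnit
  have hWG : (R + Bᵀ * P * B) * optimalGain A B R P = Bᵀ * P * A := by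
    simp only [optimalGain, ← Matrix.mul_assoc, Matrix.mul_nonsing_inv _ hdet, Matrix.one_mul]
  have hGW : (optimalGain A B R P)ᵀ * (R + Bᵀ * P * B) = Aᵀ * P * B := by
    have := congrArg Matrix.transpose hWG
    rw [Matrix.transpose_mul, hWt] at this
    simpa [Matrix.transpose_mul, hPt, Matrix.mul_assoc] using this
  have hexp : (K - optimalGain A B R P)ᵀ * (R + Bᵀ * P * B) * (K - optimalGain A B R P) =
      Kᵀ * (R + Bᵀ * P * B) * K - Kᵀ * (Bᵀ * P * A) - (Aᵀ * P * B) * K +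
        (Aᵀ * P * B) * optimalGain A B R P := by
    rw [← hWG, ← hGW]
    simp only [Matrix.transpose_sub, Matrix.sub_mul, Matrix.mul_sub, Matrix.mul_assoc]
    abel
  rw [hexp]
  simp only [feedbackCost, riccatiMap, optimalGain, Matrix.transpose_sub, Matrix.transpose_mul,
    Matrix.sub_mul, Matrix.mul_sub, Matrix.mul_add, Matrix.add_mul, Matrix.mul_assoc]
  abel

theorem riccatiMap_le_feedbackCost (hR : R.PosDef) (hP : P.PosSemidef)
    (K : Matrix (Fin M) (Fin N) ℝ) : riccatiMap A B Q R P ≤ feedbackCost A B Q R P K := by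
  rw [feedbackCost_eq_riccatiMap_add A B Q hR hP K]
  exact le_add_of_nonneg_right (posSemidef_transpose_mul_mul
    (posDef_add_transpose_mul_mul B hR hP).posSemidef _).nonneg

theorem riccatiMap_eq_feedbackCost (hR : R.PosDef) (hP : P.PosSemidef) :
    riccatiMap A B Q R P = feedbackCost A B Q R P (optimalGain A B R P) := by
  rw [feedbackCost_eq_riccatiMap_add A B Q hR hP]; simp

theorem feedbackCost_mono (h : P ≤ P') (K : Matrix (Fin M) (Fin N) ℝ) :
    feedbackCost A B Q R P K ≤ feedbackCost A B Q R P' K := by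
  unfold feedbackCost
  gcongr
  exact transpose_mul_mul_mono h _

theorem riccatiMap_mono (hR : R.PosDef) (hP : P.PosSemidef) (h : P ≤ P') :
    riccatiMap A B Q R P ≤ riccatiMap A B Q R P' := by
  have hP' : P'.PosSemidef := (hP.nonneg.trans h).posSemidef
  rw [riccatiMap_eq_feedbackCost A B Q hR hP']
  exact (riccatiMap_le_feedbackCost A B Q hR hP _).trans (feedbackCost_mono A B Q h _)

theorem le_riccatiMap (hR : R.PosDef) (hP : P.PosSemidef) : Q ≤ riccatiMap A B Q R P := by
  rw [riccatiMap_eq_feedbackCost A B Q hR hP, feedbackCost]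
  refine (le_add_of_nonneg_left ?_).trans (le_add_of_nonneg_right ?_)
  · exact (posSemidef_transpose_mul_mul hP _).nonneg
  · exact (posSemidef_transpose_mul_mul hR.posSemidef _).nonneg

theorem riccatiMap_sub_le (hR : R.PosDef) (hP : P.PosSemidef) :
    riccatiMap A B Q R P - Q ≤ Aᵀ * P * A := by
  have := riccatiMap_le_feedbackCost A B Q hR hP 0
  simpa [feedbackCost] using this

/-- The control cost `Kᵀ R K` is the only term besides `Q` that does not scale with `P`; its sign
drives both scaling inequalities below. -/
theorem feedbackCost_smul (t : ℝ) (K : Matrix (Fin M) (Fin N) ℝ) :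
    feedbackCost A B Q R (t • P) K - (Q + t • (feedbackCost A B Q R P K - Q)) =
      (1 - t) • (Kᵀ * R * K) := by
  simp only [feedbackCost, Matrix.mul_smul, Matrix.smul_mul, sub_smul, one_smul, smul_add, smul_sub]
  abel

theorem riccatiMap_smul_le (hR : R.PosDef) (hP : P.PosSemidef) {t : ℝ} (ht : 1 ≤ t) :
    riccatiMap A B Q R (t • P) ≤ Q + t • (riccatiMap A B Q R P - Q) := by
  have htP : (t • P).PosSemidef := hP.smul (by linarith)
  refine (riccatiMap_le_feedbackCost A B Q hR htP (optimalGain A B R P)).trans ?_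
  rw [riccatiMap_eq_feedbackCost A B Q hR hP, ← sub_nonneg, ← neg_sub, feedbackCost_smul,
    ← neg_smul]
  exact ((posSemidef_transpose_mul_mul hR.posSemidef _).smul (by linarith)).nonneg

theorem le_riccatiMap_smul (hR : R.PosDef) (hP : P.PosSemidef) {t : ℝ} (ht₀ : 0 ≤ t)
    (ht : t ≤ 1) : Q + t • (riccatiMap A B Q R P - Q) ≤ riccatiMap A B Q R (t • P) := by
  have htP : (t • P).PosSemidef := hP.smul ht₀
  rw [riccatiMap_eq_feedbackCost A B Q hR htP]
  -- The gain is optimal for `t • P` and merely admissible for `P`, the reverse of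
  -- `riccatiMap_smul_le`.
  set K := optimalGain A B R (t • P)
  have h1 : Q + t • (riccatiMap A B Q R P - Q) ≤ Q + t • (feedbackCost A B Q R P K - Q) := by
    rw [Matrix.le_iff, add_sub_add_left_eq_sub, ← smul_sub, sub_sub_sub_cancel_right]
    exact (Matrix.le_iff.1 (riccatiMap_le_feedbackCost A B Q hR hP K)).smul ht₀
  refine h1.trans ?_
  rw [← sub_nonneg, feedbackCost_smul]
  exact ((posSemidef_transpose_mul_mul hR.posSemidef _).smul (by linarith)).nonneg

theorem riccatiMap_posDef {Q : Matrix (Fin N) (Fin N) ℝ} (hQ : Q.PosDef) (hR : R.PosDef)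
    (hP : P.PosSemidef) : (riccatiMap A B Q R P).PosDef := by
  have := hQ.add_posSemidef (Matrix.le_iff.1 (le_riccatiMap A B Q hR hP))
  simpa using this

theorem continuousAt_riccatiMap (hR : R.PosDef) (hP : P.PosSemidef) :
    ContinuousAt (riccatiMap A B Q R) P := by
  have hdet : (R + Bᵀ * P * B).det ≠ 0 := (posDef_add_transpose_mul_mul B hR hP).det_pos.ne'
  have hinv : ContinuousAt (fun X : Matrix (Fin N) (Fin N) ℝ => (R + Bᵀ * X * B)⁻¹) P := by
    simp only [Matrix.inv_def, Ring.inverse_eq_inv']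
    have hd : ContinuousAt (fun X : Matrix (Fin N) (Fin N) ℝ => (R + Bᵀ * X * B).det) P := by
      fun_prop
    exact (hd.inv₀ hdet).smul (by fun_prop)
  unfold riccatiMap
  have h1 : ContinuousAt (fun X : Matrix (Fin N) (Fin N) ℝ => Aᵀ * X * B) P := by fun_prop
  have h2 : ContinuousAt (fun X : Matrix (Fin N) (Fin N) ℝ => Bᵀ * X * A) P := by fun_prop
  have h3 : ContinuousAt (fun X : Matrix (Fin N) (Fin N) ℝ => Aᵀ * X * A + Q) P := by fun_prop
  have key : ContinuousAt (fun X : Matrix (Fin N) (Fin N) ℝ => Aᵀ * X * A + Q -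
      Aᵀ * X * B * (R + Bᵀ * X * B)⁻¹ * (Bᵀ * X * A)) P := by
    refine h3.sub ?_
    have hc : Continuous fun p : (Matrix (Fin N) (Fin M) ℝ × Matrix (Fin M) (Fin M) ℝ) ×
      Matrix (Fin M) (Fin N) ℝ => p.1.1 * p.1.2 * p.2 := by fun_prop
    exact hc.continuousAt.comp (f := fun X => ((Aᵀ * X * B, (R + Bᵀ * X * B)⁻¹), Bᵀ * X * A))
      ((h1.prodMk hinv).prodMk h2)
  simpa only [Matrix.mul_assoc] using key

end Riccati

/-! ### Norms, the distance, and the Loewner order. -/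

section MatrixNorms

variable {N : ℕ}

theorem matSpectralNorm_nonneg (X : Matrix (Fin N) (Fin N) ℝ) : 0 ≤ matSpectralNorm X :=
  norm_nonneg _

theorem matSpectralNorm_pos {X : Matrix (Fin N) (Fin N) ℝ} (hX : X ≠ 0) :
    0 < matSpectralNorm X := by
  refine norm_pos_iff.2 fun h => hX ?_
  exact (Matrix.toEuclideanCLM (n := Fin N) (𝕜 := ℝ)).injective (h.trans (map_zero _).symm)

section
open scoped Matrix.Norms.L2Operator

theorem matSpectralNorm_eq_norm (X : Matrix (Fin N) (Fin N) ℝ) : matSpectralNorm X = ‖X‖ := rfl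

theorem matSpectralNorm_transpose_mul_self (X : Matrix (Fin N) (Fin N) ℝ) :
    matSpectralNorm (Xᵀ * X) = matSpectralNorm X ^ 2 := by
  have := l2_opNorm_conjTranspose_mul_self X
  rw [conjTranspose_eq_transpose_of_trivial] at this
  rw [sq]; exact this

theorem matSpectralNorm_le {X : Matrix (Fin N) (Fin N) ℝ} {c : ℝ} (hc : 0 ≤ c)
    (h₁ : -(c • 1) ≤ X) (h₂ : X ≤ c • 1) : matSpectralNorm X ≤ c := by
  have hX : IsSelfAdjoint X := by
    have h : IsSelfAdjoint (c • 1 - X) := (Matrix.le_iff.1 h₂).isHermitian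
    have h' : IsSelfAdjoint (c • (1 : Matrix (Fin N) (Fin N) ℝ)) :=
      (IsSelfAdjoint.all c).smul (IsSelfAdjoint.one _)
    simpa using h'.sub h
  rw [matSpectralNorm_eq_norm, ← cfc_id' ℝ X]
  refine norm_cfc_le hc fun x hx => ?_
  rw [Real.norm_eq_abs, abs_le]
  rw [← Algebra.algebraMap_eq_smul_one] at h₁ h₂
  rw [← map_neg] at h₁
  exact ⟨(algebraMap_le_iff_le_spectrum hX).1 h₁ x hx, (le_algebraMap_iff_spectrum_le hX).1 h₂ x hx⟩

theorem le_matSpectralNorm_smul_one {X : Matrix (Fin N) (Fin N) ℝ} (hX : X.IsHermitian) :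
    X ≤ matSpectralNorm X • 1 := by
  have hX' : IsSelfAdjoint X := hX
  rw [← Algebra.algebraMap_eq_smul_one, le_algebraMap_iff_spectrum_le hX']
  intro x hx
  have h := IsometricContinuousFunctionalCalculus.norm_spectrum_le (𝕜 := ℝ) X hx hX'
  exact (le_abs_self x).trans h

end

theorem matSpectralNorm_le_mul {X P : Matrix (Fin N) (Fin N) ℝ} (hP : P.PosSemidef) {c : ℝ}
    (hc : 0 ≤ c) (h₁ : -(c • P) ≤ X) (h₂ : X ≤ c • P) :
    matSpectralNorm X ≤ c * matSpectralNorm P := by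
  have h : c • P ≤ (c * matSpectralNorm P) • 1 := by
    rw [mul_smul, Matrix.le_iff, ← smul_sub]
    exact (Matrix.le_iff.1 (le_matSpectralNorm_smul_one hP.isHermitian)).smul hc
  exact matSpectralNorm_le (mul_nonneg hc (matSpectralNorm_nonneg _))
    ((neg_le_neg h).trans h₁) (h₂.trans h)

theorem one_le_matSpectralNorm_inv_smul {Q : Matrix (Fin N) (Fin N) ℝ} (hQ : Q.PosDef) :
    1 ≤ matSpectralNorm Q⁻¹ • Q := by
  have h := Matrix.le_iff.1 (le_matSpectralNorm_smul_one hQ.inv.isHermitian)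
  have hdet : IsUnit Q.det := (Matrix.isUnit_iff_isUnit_det _).1 hQ.isUnit
  -- The product of the commuting nonnegative matrices `Q` and `‖Q⁻¹‖ • 1 - Q⁻¹` is `‖Q⁻¹‖ • Q - 1`.
  have hc : Commute Q (matSpectralNorm Q⁻¹ • 1 - Q⁻¹) := by
    simp [Commute, SemiconjBy, mul_sub, sub_mul, Matrix.mul_nonsing_inv _ hdet,
      Matrix.nonsing_inv_mul _ hdet]
  have := hc.mul_nonneg hQ.posSemidef.nonneg h.nonneg
  rw [mul_sub, Matrix.mul_nonsing_inv _ hdet, mul_smul_comm, mul_one] at this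
  exact sub_nonneg.1 this

theorem transpose_mul_mul_le_smul (A : Matrix (Fin N) (Fin N) ℝ) {P Q : Matrix (Fin N) (Fin N) ℝ}
    (hP : P.PosSemidef) (hQ : Q.PosDef) :
    Aᵀ * P * A ≤ (matSpectralNorm Q⁻¹ * matSpectralNorm A ^ 2 * matSpectralNorm P) • Q := by
  have h1 := transpose_mul_mul_mono (le_matSpectralNorm_smul_one hP.isHermitian) A
  have hA : (Aᵀ * A).IsHermitian := by
    simpa [conjTranspose_eq_transpose_of_trivial] using isHermitian_conjTranspose_mul_self A
  have h2 := Matrix.le_iff.1 (le_matSpectralNorm_smul_one hA)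
  have h3 := Matrix.le_iff.1 (one_le_matSpectralNorm_inv_smul hQ)
  rw [matSpectralNorm_transpose_mul_self] at h2
  refine h1.trans ?_
  have h4 := (h2.smul (matSpectralNorm_nonneg P)).add
    (h3.smul (mul_nonneg (matSpectralNorm_nonneg P) (sq_nonneg (matSpectralNorm A))))
  rw [Matrix.le_iff]
  convert h4 using 1
  simp only [Matrix.mul_smul, Matrix.smul_mul, Matrix.mul_one, smul_sub, smul_smul]
  rw [sub_add_sub_cancel']
  congr 2
  ring

/-- Cauchy–Schwarz on each row, applied to an eigenvector. -/
theorem abs_le_frobNorm_of_mem_spectrum {L : Matrix (Fin N) (Fin N) ℝ} {μ : ℝ}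
    (hμ : μ ∈ spectrum ℝ L) : |μ| ≤ frobNorm L := by
  rw [← Matrix.spectrum_toLin', ← Module.End.hasEigenvalue_iff_mem_spectrum] at hμ
  obtain ⟨v, hv⟩ := hμ.exists_hasEigenvector
  have hLv : L *ᵥ v = μ • v := by simpa using hv.apply_eq_smul
  have hpos : 0 < ∑ j, v j ^ 2 := by
    obtain ⟨j, hj⟩ := Function.ne_iff.1 hv.2
    exact Finset.sum_pos' (fun i _ => sq_nonneg _) ⟨j, Finset.mem_univ j, by simpa [sq_pos_iff] using hj⟩
  refine Real.abs_le_sqrt (le_of_mul_le_mul_right ?_ hpos)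
  calc μ ^ 2 * ∑ j, v j ^ 2 = ∑ i, ((L *ᵥ v) i) ^ 2 := by
        simp [hLv, mul_pow, Finset.mul_sum]
    _ ≤ ∑ i, (∑ j, L i j ^ 2) * ∑ j, v j ^ 2 :=
        Finset.sum_le_sum fun i _ =>
          Finset.sum_mul_sq_le_sq_mul_sq Finset.univ (fun j => L i j) v
    _ = (∑ i, ∑ j, L i j ^ 2) * ∑ j, v j ^ 2 := by rw [Finset.sum_mul]

theorem thomsonDist_nonneg (X Y : Matrix (Fin N) (Fin N) ℝ) : 0 ≤ thomsonDist X Y :=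
  Real.sqrt_nonneg _

/-- Each eigenvalue `x` of `C = Y^{-1/2} P Y^{-1/2}` has `|log x|` at most the Frobenius norm of
`log C`. This bounds `C` by multiples of the identity, and congruence by `Y^{1/2}` transfers the
bounds to `P` and `Y`. -/
theorem exp_thomsonDist_bounds {P Y : Matrix (Fin N) (Fin N) ℝ} (hP : P.PosDef) (hY : Y.PosDef) :
    Real.exp (-thomsonDist P Y) • Y ≤ P ∧ P ≤ Real.exp (thomsonDist P Y) • Y := by
  set S : Matrix (Fin N) (Fin N) ℝ := cfc Real.sqrt Y with hS
  have hYs : IsSelfAdjoint Y := hY.isHermitian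
  have hSS : S * S = Y := by
    rw [hS, ← cfc_mul Real.sqrt Real.sqrt Y]
    conv_rhs => rw [← cfc_id' ℝ Y]
    refine cfc_congr fun x hx => Real.mul_self_sqrt ?_
    exact spectrum_nonneg_of_nonneg hY.posSemidef.nonneg hx
  have hSsa : IsSelfAdjoint S := cfc_predicate _ _
  have hSu : IsUnit S.det := by
    have := hY.det_pos.ne'
    rw [← hSS, Matrix.det_mul] at this
    exact (left_ne_zero_of_mul this).isUnit
  have hSt : Sᵀ = S := (conjTranspose_eq_transpose_of_trivial S).symm.trans hSsa
  have hIt : (S⁻¹)ᵀ = S⁻¹ := by rw [Matrix.transpose_nonsing_inv, hSt]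
  set C := S⁻¹ * P * S⁻¹ with hC
  have hCpos : C.PosDef := by
    have := hP.conjTranspose_mul_mul_same (B := S⁻¹) ?_
    · rwa [conjTranspose_eq_transpose_of_trivial, hIt] at this
    · exact Matrix.mulVec_injective_of_isUnit
        ((Matrix.isUnit_nonsing_inv_iff).2 ((Matrix.isUnit_iff_isUnit_det _).2 hSu))
  have hCs : IsSelfAdjoint C := hCpos.isHermitian
  have hSCS : S * C * S = P := by
    rw [hC, ← Matrix.mul_assoc, ← Matrix.mul_assoc, Matrix.mul_nonsing_inv _ hSu, Matrix.one_mul,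
      Matrix.mul_assoc, Matrix.nonsing_inv_mul _ hSu, Matrix.mul_one]
  have hx : ∀ x ∈ spectrum ℝ C, 0 < x ∧ |Real.log x| ≤ thomsonDist P Y := by
    intro x hx
    have hC0 : ∀ y ∈ spectrum ℝ C, y ≠ 0 := fun y hy h0 => by
      rw [h0] at hy
      exact spectrum.zero_notMem ℝ hCpos.isUnit hy
    refine ⟨lt_of_le_of_ne (spectrum_nonneg_of_nonneg hCpos.posSemidef.nonneg hx)
      (hC0 x hx).symm, abs_le_frobNorm_of_mem_spectrum ?_⟩
    have hcont : ContinuousOn Real.log (spectrum ℝ C) :=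
      Real.continuousOn_log.mono fun y hy => hC0 y hy
    change Real.log x ∈ spectrum ℝ (cfc Real.log C)
    rw [cfc_map_spectrum (R := ℝ) Real.log C hCs hcont]
    exact ⟨x, hx, rfl⟩
  have hlow : Real.exp (-thomsonDist P Y) • 1 ≤ C := by
    rw [← Algebra.algebraMap_eq_smul_one, algebraMap_le_iff_le_spectrum hCs]
    intro x hxs
    rw [← Real.le_log_iff_exp_le (hx x hxs).1]
    exact neg_le_of_abs_le (hx x hxs).2
  have hup : C ≤ Real.exp (thomsonDist P Y) • 1 := by
    rw [← Algebra.algebraMap_eq_smul_one, le_algebraMap_iff_spectrum_le hCs]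
    intro x hxs
    rw [← Real.log_le_iff_le_exp (hx x hxs).1]
    exact le_of_abs_le (hx x hxs).2
  have h1 := transpose_mul_mul_mono hlow S
  have h2 := transpose_mul_mul_mono hup S
  rw [hSt, hSCS, Matrix.mul_smul, Matrix.smul_mul, Matrix.mul_one, hSS] at h1 h2
  exact ⟨h1, h2⟩

theorem exp_neg_smul_le_iff {X Y : Matrix (Fin N) (Fin N) ℝ} {d : ℝ} :
    Real.exp (-d) • X ≤ Y ↔ X ≤ Real.exp d • Y := by
  simp only [Matrix.le_iff]
  constructor <;> intro h
  · have := h.smul (Real.exp_pos d).le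
    rwa [smul_sub, smul_smul, ← Real.exp_add, add_neg_cancel, Real.exp_zero, one_smul] at this
  · have := h.smul (Real.exp_pos (-d)).le
    rwa [smul_sub, smul_smul, ← Real.exp_add, neg_add_cancel, Real.exp_zero, one_smul] at this

end MatrixNorms

/-! ### Contraction of order intervals around a fixed point. -/

section Contraction

/-- Apply `1 + x ≤ e^x` at `ρ d` with weight `1` and at `-(1 - ρ) d` with weight `γ e^d`. The terms
linear in `d` leave `ρ - γ (1 - ρ) e^d`, and `ρ` is chosen so that this vanishes at `d = δ`. -/
theorem one_add_mul_exp_le {γ δ d : ℝ} (hγ : 0 ≤ γ) (hd₀ : 0 ≤ d) (hd : d ≤ δ) :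
    1 + γ * Real.exp d ≤ Real.exp (γ / (γ + Real.exp (-δ)) * d) * (1 + γ) := by
  set e := Real.exp (-δ) with he
  have hepos : 0 < e := Real.exp_pos _
  set ρ := γ / (γ + e) with hρ
  have hρe : ρ * (γ + e) = γ := div_mul_cancel₀ _ (by positivity)
  have hρ0 : 0 ≤ ρ := by positivity
  have hE : e * Real.exp d ≤ 1 := by
    rw [he, ← Real.exp_add]; exact Real.exp_le_one_iff.2 (by linarith)
  have h1 : 1 + ρ * d ≤ Real.exp (ρ * d) := by linarith [Real.add_one_le_exp (ρ * d)]
  have h2 : Real.exp d * (1 - (1 - ρ) * d) ≤ Real.exp (ρ * d) := by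
    have := Real.add_one_le_exp (-((1 - ρ) * d))
    calc Real.exp d * (1 - (1 - ρ) * d) ≤ Real.exp d * Real.exp (-((1 - ρ) * d)) := by
          gcongr; linarith
      _ = Real.exp (ρ * d) := by rw [← Real.exp_add]; congr 1; ring
  have h3 : γ * (1 - ρ) * Real.exp d ≤ ρ := by
    have : γ * (1 - ρ) = ρ * e := by linear_combination (-1 : ℝ) * hρe
    rw [this, mul_assoc]; exact mul_le_of_le_one_right hρ0 hE
  nlinarith [mul_le_mul_of_nonneg_left h2 hγ, mul_le_mul_of_nonneg_right h3 hd₀]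

theorem exp_neg_mul_le {γ δ d : ℝ} (hγ : 0 ≤ γ) (hd₀ : 0 ≤ d) (hd : d ≤ δ) :
    Real.exp (-(γ / (γ + Real.exp (-δ)) * d)) * (1 + γ) ≤ 1 + γ * Real.exp (-d) := by
  set e := Real.exp (-δ) with he
  have hepos : 0 < e := Real.exp_pos _
  have he1 : e ≤ 1 := Real.exp_le_one_iff.2 (by linarith)
  set ρ := γ / (γ + e) with hρ
  have hρe : ρ * (γ + e) = γ := div_mul_cancel₀ _ (by positivity)
  have hρ0 : 0 ≤ ρ := by positivity
  have h1 : 1 + ρ * d ≤ Real.exp (ρ * d) := by linarith [Real.add_one_le_exp (ρ * d)]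
  have h2 : 1 - (1 - ρ) * d ≤ Real.exp (-d) * Real.exp (ρ * d) := by
    rw [← Real.exp_add]
    linarith [Real.add_one_le_exp (-d + ρ * d)]
  have h3 : γ * (1 - ρ) ≤ ρ := by
    have : γ * (1 - ρ) = ρ * e := by linear_combination (-1 : ℝ) * hρe
    rw [this]; exact mul_le_of_le_one_right hρ0 he1
  rw [Real.exp_neg, inv_mul_le_iff₀ (Real.exp_pos _)]
  nlinarith [mul_le_mul_of_nonneg_left h2 hγ, mul_le_mul_of_nonneg_right h3 hd₀]

variable {N M : ℕ} (A : Matrix (Fin N) (Fin N) ℝ) (B : Matrix (Fin N) (Fin M) ℝ)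
    {Q : Matrix (Fin N) (Fin N) ℝ} {R : Matrix (Fin M) (Fin M) ℝ}
    {P X : Matrix (Fin N) (Fin N) ℝ}

theorem riccatiMap_contraction (hR : R.PosDef) (hP : P.PosSemidef) (hX : X.PosSemidef)
    (hfix : P = riccatiMap A B Q R P) {γ δ d : ℝ} (hγ : 0 ≤ γ) (hPQ : P - Q ≤ γ • Q)
    (hd₀ : 0 ≤ d) (hd : d ≤ δ) (h₁ : Real.exp (-d) • P ≤ X) (h₂ : X ≤ Real.exp d • P) :
    Real.exp (-(γ / (γ + Real.exp (-δ)) * d)) • P ≤ riccatiMap A B Q R X ∧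
      riccatiMap A B Q R X ≤ Real.exp (γ / (γ + Real.exp (-δ)) * d) • P := by
  have hγ1 : 0 < 1 + γ := by linarith
  have hPQ' := Matrix.le_iff.1 hPQ
  have cancel : ∀ Z : Matrix (Fin N) (Fin N) ℝ, ((1 + γ) • Z).PosSemidef → Z.PosSemidef := by
    intro Z hZ
    have := hZ.smul (inv_pos.2 hγ1).le
    rwa [smul_smul, inv_mul_cancel₀ hγ1.ne', one_smul] at this
  constructor
  · have hmono := riccatiMap_mono A B Q hR (hP.smul (Real.exp_pos (-d)).le) h₁
    have hsub := le_riccatiMap_smul A B Q hR hP (Real.exp_pos (-d)).le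
      (Real.exp_le_one_iff.2 (by linarith))
    rw [← hfix] at hsub
    refine le_trans ?_ (hsub.trans hmono)
    rw [Matrix.le_iff]
    refine cancel _ ?_
    have hs := exp_neg_mul_le hγ hd₀ hd
    have key := (hP.smul (sub_nonneg.2 hs)).add
      -- Multiplied by `1 + γ`, the gap is a nonnegative multiple of `P` (the scalar inequality)
      -- plus `1 - e^{-d}` times `γ Q - (P - Q)`.
      (hPQ'.smul (sub_nonneg.2 (Real.exp_le_one_iff.2 (neg_nonpos.2 hd₀))))
    convert key using 1
    module
  · have hmono := riccatiMap_mono A B Q hR hX h₂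
    have hsub := riccatiMap_smul_le A B Q hR hP (Real.one_le_exp hd₀)
    rw [← hfix] at hsub
    refine (hmono.trans hsub).trans ?_
    rw [Matrix.le_iff]
    refine cancel _ ?_
    have hs := one_add_mul_exp_le hγ hd₀ hd
    have key := (hP.smul (sub_nonneg.2 hs)).add
      (hPQ'.smul (sub_nonneg.2 (Real.one_le_exp hd₀)))
    convert key using 1
    module

end Contraction

/-! ### Lyapunov series and existence of a solution. -/

section Existence

theorem isClosed_setOf_posSemidef {n : ℕ} :
    IsClosed {X : Matrix (Fin n) (Fin n) ℝ | X.PosSemidef} := by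
  simp only [posSemidef_iff_dotProduct_mulVec, Set.ofPred_and, Set.ofPred_forall, IsHermitian]
  refine (isClosed_eq (by fun_prop) (by fun_prop)).inter (isClosed_iInter fun x => ?_)
  exact isClosed_le (by fun_prop) (by fun_prop)

theorem isClosed_setOf_matrix_le {n : ℕ} {f g : Matrix (Fin n) (Fin n) ℝ → Matrix (Fin n) (Fin n) ℝ}
    (hf : Continuous f) (hg : Continuous g) : IsClosed {X | f X ≤ g X} :=
  isClosed_setOf_posSemidef.preimage (hg.sub hf)

section Gelfand

attribute [local instance] Matrix.frobeniusNormedRing Matrix.frobeniusNormedAlgebra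

/-- Gelfand's formula over `ℂ`; the Frobenius norm is unchanged by the embedding of real matrices.
-/
theorem IsSchurStable.exists_norm_pow_le {n : ℕ} {C : Matrix (Fin n) (Fin n) ℝ}
    (hC : IsSchurStable C) :
    ∃ r : ℝ, 0 ≤ r ∧ r < 1 ∧ ∀ᶠ k : ℕ in atTop, ‖C ^ k‖ ≤ r ^ k := by
  set D : Matrix (Fin n) (Fin n) ℂ := C.map (algebraMap ℝ ℂ) with hD
  have hrad : spectralRadius ℂ D < 1 := by
    -- The spectrum can be empty only when `n = 0`.
    rcases (spectrum ℂ D).eq_empty_or_nonempty with h | h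
    · simp [spectralRadius, h]
    · refine spectrum.spectralRadius_lt_of_forall_lt_of_nonempty (r := 1) h fun z hz => ?_
      exact_mod_cast hC z hz
  obtain ⟨r, hr, hr1⟩ := ENNReal.lt_iff_exists_nnreal_btwn.1 hrad
  refine ⟨r, r.2, by exact_mod_cast hr1, ?_⟩
  filter_upwards [(spectrum.pow_nnnorm_pow_one_div_tendsto_nhds_spectralRadius
    D).eventually_lt_const hr, eventually_gt_atTop 0] with k hk hk0
  have hk0' : (0 : ℝ) < k := by exact_mod_cast hk0
  have hk := hk.le
  rw [one_div, ENNReal.rpow_inv_le_iff hk0', ENNReal.rpow_natCast] at hk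
  have hk' : ‖D ^ k‖ ≤ (r : ℝ) ^ k := by exact_mod_cast hk
  have hmap : D ^ k = (C ^ k).map (algebraMap ℝ ℂ) := by
    have := map_pow ((algebraMap ℝ ℂ).mapMatrix) C k
    exact this.symm
  rw [hmap, frobenius_norm_map_eq _ _ (fun a => by simp)] at hk'
  exact hk'

theorem IsSchurStable.summable_transpose_pow_mul_mul_pow {n : ℕ} {C : Matrix (Fin n) (Fin n) ℝ}
    (hC : IsSchurStable C) (W : Matrix (Fin n) (Fin n) ℝ) :
    Summable fun k : ℕ => Cᵀ ^ k * W * C ^ k := by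
  obtain ⟨r, hr0, hr1, hr⟩ := hC.exists_norm_pow_le
  refine Summable.of_norm_bounded_eventually_nat (g := fun k => ‖W‖ * (r ^ 2) ^ k)
    ((summable_geometric_of_lt_one (sq_nonneg r) (by nlinarith)).mul_left _) ?_
  filter_upwards [hr] with k hk
  have ht : ‖Cᵀ ^ k‖ ≤ r ^ k := by rwa [← transpose_pow, frobenius_norm_transpose]
  calc ‖Cᵀ ^ k * W * C ^ k‖ ≤ ‖Cᵀ ^ k‖ * ‖W‖ * ‖C ^ k‖ :=
        (norm_mul_le _ _).trans (by gcongr; exact norm_mul_le _ _)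
    _ ≤ r ^ k * ‖W‖ * r ^ k := by gcongr
    _ = ‖W‖ * (r ^ 2) ^ k := by ring

end Gelfand

theorem IsSchurStable.exists_lyapunov {n : ℕ} {C W : Matrix (Fin n) (Fin n) ℝ}
    (hC : IsSchurStable C) (hW : W.PosSemidef) :
    ∃ S : Matrix (Fin n) (Fin n) ℝ, S.PosSemidef ∧ Cᵀ * S * C + W = S := by
  have hs := hC.summable_transpose_pow_mul_mul_pow W
  refine ⟨∑' k : ℕ, Cᵀ ^ k * W * C ^ k, ?_, ?_⟩
  -- The witness is the total cost `∑ (Cᵀ)ᵏ W Cᵏ`; splitting off `k = 0` gives the equation.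
  · refine isClosed_setOf_posSemidef.mem_of_tendsto hs.hasSum (Eventually.of_forall fun s => ?_)
    refine posSemidef_sum s fun k _ => ?_
    rw [← transpose_pow]
    exact posSemidef_transpose_mul_mul hW _
  · conv_rhs => rw [hs.tsum_eq_zero_add]
    rw [← hs.tsum_mul_left, ← (hs.mul_left _).tsum_mul_right, add_comm]
    simp only [pow_zero, one_mul, mul_one, pow_succ' Cᵀ, pow_succ C, mul_assoc]

variable {N M : ℕ} (A : Matrix (Fin N) (Fin N) ℝ) (B : Matrix (Fin N) (Fin M) ℝ)
    {Q : Matrix (Fin N) (Fin N) ℝ} {R : Matrix (Fin M) (Fin M) ℝ}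

theorem exists_posDef_eq_riccatiMap (hQ : Q.PosDef) (hR : R.PosDef) (hAB : IsStabilizable A B) :
    ∃ P : Matrix (Fin N) (Fin N) ℝ, P.PosDef ∧ P = riccatiMap A B Q R P := by
  obtain ⟨K, hK⟩ := hAB
  obtain ⟨S, hS, hSfix⟩ := hK.exists_lyapunov
    (hQ.posSemidef.add (posSemidef_transpose_mul_mul hR.posSemidef K))
  -- `S` is the infinite-horizon cost of the stabilizing gain `K`, hence a supersolution that traps
  -- the orbit of `0`.
  have hfS : riccatiMap A B Q R S ≤ S := by
    refine (riccatiMap_le_feedbackCost A B Q hR hS K).trans_eq ?_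
    rw [feedbackCost, add_assoc, hSfix]
  set Y : ℕ → Matrix (Fin N) (Fin N) ℝ := fun k => (riccatiMap A B Q R)^[k] 0 with hY
  have hYs : ∀ k, Y (k + 1) = riccatiMap A B Q R (Y k) := fun k => by
    simp only [hY, Function.iterate_succ_apply']
  have hY0 : Y 0 = 0 := rfl
  have hYpos : ∀ k, (Y k).PosSemidef := by
    intro k
    induction k with
    | zero => exact hY0 ▸ PosSemidef.zero
    | succ k ih => rw [hYs]; exact (riccatiMap_posDef A B hQ hR ih).posSemidef
  have hYS : ∀ k, Y k ≤ S := by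
    intro k
    induction k with
    | zero => exact hS.nonneg
    | succ k ih => rw [hYs]; exact (riccatiMap_mono A B Q hR (hYpos k) ih).trans hfS
  have hYmono : Monotone Y := by
    refine monotone_nat_of_le_succ fun k => ?_
    induction k with
    | zero => exact (hYpos 1).nonneg
    | succ k ih => rw [hYs (k + 1), hYs k]; exact riccatiMap_mono A B Q hR (hYpos k) (hYs k ▸ ih)
  obtain ⟨P, φ, hφ, hlim⟩ : ∃ P, ∃ φ : ℕ → ℕ, StrictMono φ ∧ Tendsto (Y ∘ φ) atTop (𝓝 P) := by
    let e := (Matrix.toEuclideanCLM (n := Fin N)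
      (𝕜 := ℝ)).toAlgEquiv.toLinearEquiv.toContinuousLinearEquiv
    have hb : ∀ k, e (Y k) ∈ Metric.closedBall (0 : EuclideanSpace ℝ (Fin N) →L[ℝ] _)
        (matSpectralNorm S) := by
      intro k
      rw [mem_closedBall_zero_iff]
      have := matSpectralNorm_le_mul hS zero_le_one (X := Y k) (by
        rw [one_smul]; exact (neg_nonpos.2 hS.nonneg).trans (hYpos k).nonneg) (by
        rw [one_smul]; exact hYS k)
      rw [one_mul] at this
      exact this
    obtain ⟨T, -, φ, hφ, hlim⟩ := tendsto_subseq_of_bounded Metric.isBounded_closedBall hb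
    refine ⟨e.symm T, φ, hφ, ?_⟩
    have := (e.symm.continuous.tendsto T).comp hlim
    simpa [Function.comp_def] using this
  -- Compactness yields only a convergent subsequence; monotonicity makes its limit bound the whole
  -- orbit.
  have hYP : ∀ k, Y k ≤ P := fun k =>
    (isClosed_setOf_matrix_le continuous_const continuous_id).mem_of_tendsto hlim
      ((eventually_ge_atTop k).mono fun j hj => hYmono (hj.trans (hφ.id_le j)))
  have hP : P.PosSemidef := (hYP 0).posSemidef
  have hlim' : Tendsto (fun j => Y (φ j + 1)) atTop (𝓝 (riccatiMap A B Q R P)) := by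
    simp only [hYs]
    exact (continuousAt_riccatiMap A B Q hR hP).tendsto.comp hlim
  have hle : riccatiMap A B Q R P ≤ P :=
    (isClosed_setOf_matrix_le continuous_id continuous_const).mem_of_tendsto hlim'
      (Eventually.of_forall fun j => hYP _)
  have hge : P ≤ riccatiMap A B Q R P :=
    (isClosed_setOf_matrix_le continuous_id continuous_const).mem_of_tendsto hlim
      (Eventually.of_forall fun j => by
        refine (hYmono (Nat.le_succ (φ j))).trans ?_
        rw [Nat.succ_eq_add_one, hYs]
        exact riccatiMap_mono A B Q hR (hYpos _) (hYP _))
  have heq := le_antisymm hge hle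
  exact ⟨P, heq ▸ riccatiMap_posDef A B hQ hR hP, heq⟩

end Existence

/-! ### The rate, the error bound and convergence. -/

section Main

variable {N M : ℕ} {A : Matrix (Fin N) (Fin N) ℝ} {B : Matrix (Fin N) (Fin M) ℝ}
    {Q : Matrix (Fin N) (Fin N) ℝ} {R : Matrix (Fin M) (Fin M) ℝ}
    {P : Matrix (Fin N) (Fin N) ℝ} {Y : ℕ → Matrix (Fin N) (Fin N) ℝ}

/-- The form `γ / (γ + e^{-δ})` absorbs the case `A = 0`, where `γ = 0`. -/
theorem riccatiRate_eq (A : Matrix (Fin N) (Fin N) ℝ) (hQ : Q.PosDef) (hP : P.PosDef)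
    (P₀ : Matrix (Fin N) (Fin N) ℝ) :
    riccatiRate A Q P P₀ = (matSpectralNorm Q⁻¹ * matSpectralNorm A ^ 2 * matSpectralNorm P) /
      (matSpectralNorm Q⁻¹ * matSpectralNorm A ^ 2 * matSpectralNorm P +
        Real.exp (-thomsonDist P P₀)) := by
  unfold riccatiRate
  split_ifs with hA
  · simp [hA, matSpectralNorm]
  · have : Nontrivial (Matrix (Fin N) (Fin N) ℝ) := ⟨A, 0, hA⟩
    have h1 := matSpectralNorm_pos hA
    have h2 := matSpectralNorm_pos hP.isUnit.ne_zero
    have h3 := matSpectralNorm_pos hQ.inv.isUnit.ne_zero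
    have h4 := Real.exp_pos (-thomsonDist P P₀)
    field_simp

theorem riccatiRate_nonneg (A : Matrix (Fin N) (Fin N) ℝ) (hQ : Q.PosDef) (hP : P.PosDef)
    (P₀ : Matrix (Fin N) (Fin N) ℝ) : 0 ≤ riccatiRate A Q P P₀ := by
  rw [riccatiRate_eq A hQ hP]
  have := matSpectralNorm_nonneg Q⁻¹
  have := matSpectralNorm_nonneg P
  positivity

theorem riccatiRate_lt_one (A : Matrix (Fin N) (Fin N) ℝ) (hQ : Q.PosDef) (hP : P.PosDef)
    (P₀ : Matrix (Fin N) (Fin N) ℝ) : riccatiRate A Q P P₀ < 1 := by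
  rw [riccatiRate_eq A hQ hP]
  have := matSpectralNorm_nonneg Q⁻¹
  have := matSpectralNorm_nonneg P
  rw [div_lt_one (by positivity)]
  linarith [Real.exp_pos (-thomsonDist P P₀)]

theorem riccatiIterate_posDef (hQ : Q.PosDef) (hR : R.PosDef) (hY₀ : (Y 0).PosDef)
    (hY : ∀ k, Y (k + 1) = riccatiMap A B Q R (Y k)) (k : ℕ) : (Y k).PosDef := by
  induction k with
  | zero => exact hY₀
  | succ k ih => rw [hY]; exact riccatiMap_posDef A B hQ hR ih.posSemidef

/-- The induction carries order bounds rather than distances of later iterates. The exponent never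
exceeds the initial distance, so the same `ρ` serves at every step. -/
theorem riccatiIterate_bounds (hQ : Q.PosDef) (hR : R.PosDef) (hP : P.PosDef)
    (hfix : P = riccatiMap A B Q R P) (hY₀ : (Y 0).PosDef)
    (hY : ∀ k, Y (k + 1) = riccatiMap A B Q R (Y k)) (k : ℕ) :
    Real.exp (-(riccatiRate A Q P (Y 0) ^ k * thomsonDist P (Y 0))) • P ≤ Y k ∧
      Y k ≤ Real.exp (riccatiRate A Q P (Y 0) ^ k * thomsonDist P (Y 0)) • P := by
  induction k with
  | zero =>
    obtain ⟨h₁, h₂⟩ := exp_thomsonDist_bounds hP hY₀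
    rw [pow_zero, one_mul]
    exact ⟨exp_neg_smul_le_iff.2 h₂, exp_neg_smul_le_iff.1 h₁⟩
  | succ k ih =>
    have hγ : 0 ≤ matSpectralNorm Q⁻¹ * matSpectralNorm A ^ 2 * matSpectralNorm P :=
      mul_nonneg (mul_nonneg (matSpectralNorm_nonneg _) (sq_nonneg _)) (matSpectralNorm_nonneg _)
    have hPQ : P - Q ≤ (matSpectralNorm Q⁻¹ * matSpectralNorm A ^ 2 * matSpectralNorm P) • Q := by
      have h := riccatiMap_sub_le A B Q hR hP.posSemidef
      rw [← hfix] at h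
      exact h.trans (transpose_mul_mul_le_smul A hP.posSemidef hQ)
    have hρ0 := riccatiRate_nonneg A hQ hP (Y 0)
    have hρ1 := (riccatiRate_lt_one A hQ hP (Y 0)).le
    have hδ := thomsonDist_nonneg P (Y 0)
    have h := riccatiMap_contraction A B hR hP.posSemidef
      (riccatiIterate_posDef hQ hR hY₀ hY k).posSemidef hfix hγ hPQ
      (mul_nonneg (pow_nonneg hρ0 k) hδ) (mul_le_of_le_one_left hδ (pow_le_one₀ hρ0 hρ1)) ih.1 ih.2
    rw [← riccatiRate_eq A hQ hP, ← mul_assoc, ← pow_succ', ← hY] at h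
    exact h

theorem matSpectralNorm_sub_riccatiIterate_le (hQ : Q.PosDef) (hR : R.PosDef) (hP : P.PosDef)
    (hfix : P = riccatiMap A B Q R P) (hY₀ : (Y 0).PosDef)
    (hY : ∀ k, Y (k + 1) = riccatiMap A B Q R (Y k)) (k : ℕ) :
    matSpectralNorm (P - Y k) ≤
      (Real.exp (riccatiRate A Q P (Y 0) ^ k * thomsonDist P (Y 0)) - 1) * matSpectralNorm P := by
  obtain ⟨h₁, h₂⟩ := riccatiIterate_bounds hQ hR hP hfix hY₀ hY k
  set d := riccatiRate A Q P (Y 0) ^ k * thomsonDist P (Y 0) with hd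
  have hd0 : 0 ≤ d :=
    mul_nonneg (pow_nonneg (riccatiRate_nonneg A hQ hP _) k) (thomsonDist_nonneg _ _)
  refine matSpectralNorm_le_mul hP.posSemidef (sub_nonneg.2 (Real.one_le_exp hd0)) ?_ ?_
  · rw [Matrix.le_iff] at h₂ ⊢
    convert h₂ using 1
    module
  -- This side yields the factor `1 - e^{-d}`, which is at most `e^d - 1`.
  · have hc : 0 ≤ Real.exp d + Real.exp (-d) - 2 := by
      linarith [Real.add_one_le_exp d, Real.add_one_le_exp (-d)]
    rw [Matrix.le_iff] at h₁ ⊢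
    convert h₁.add (hP.posSemidef.smul hc) using 1
    module

theorem tendsto_riccatiIterate (hQ : Q.PosDef) (hR : R.PosDef) (hP : P.PosDef)
    (hfix : P = riccatiMap A B Q R P) (hY₀ : (Y 0).PosDef)
    (hY : ∀ k, Y (k + 1) = riccatiMap A B Q R (Y k)) : Tendsto Y atTop (𝓝 P) := by
  have hpow := tendsto_pow_atTop_nhds_zero_of_lt_one (riccatiRate_nonneg A hQ hP (Y 0))
    (riccatiRate_lt_one A hQ hP (Y 0))
  have hbound : Tendsto (fun k : ℕ =>
      (Real.exp (riccatiRate A Q P (Y 0) ^ k * thomsonDist P (Y 0)) - 1) * matSpectralNorm P)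
      atTop (𝓝 0) := by
    have h := (((Real.continuous_exp.tendsto _).comp
      (hpow.mul_const (thomsonDist P (Y 0)))).sub_const 1).mul_const (matSpectralNorm P)
    simpa [Function.comp_def] using h
  have hnorm : Tendsto (fun k => matSpectralNorm (P - Y k)) atTop (𝓝 0) :=
    squeeze_zero (fun _ => matSpectralNorm_nonneg _)
      (matSpectralNorm_sub_riccatiIterate_le hQ hR hP hfix hY₀ hY) hbound
  let e := (Matrix.toEuclideanCLM (n := Fin N)
    (𝕜 := ℝ)).toAlgEquiv.toLinearEquiv.toContinuousLinearEquiv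
  have h0 : Tendsto (fun k => e (P - Y k)) atTop (𝓝 0) := tendsto_zero_iff_norm_tendsto_zero.2 hnorm
  have h1 := (e.symm.continuous.tendsto 0).comp h0
  simp only [Function.comp_def, ContinuousLinearEquiv.symm_apply_apply, map_zero] at h1
  simpa using (tendsto_const_nhds (x := P)).sub h1

end Main

end Auxiliary

theorem mainTheorem3 {N M : ℕ}
    (A : Matrix (Fin N) (Fin N) ℝ) (B : Matrix (Fin N) (Fin M) ℝ)
    (Q : Matrix (Fin N) (Fin N) ℝ) (R : Matrix (Fin M) (Fin M) ℝ)
    (hQ : Q.PosDef) (hR : R.PosDef) (hAB : IsStabilizable A B) :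
    ∃ P : Matrix (Fin N) (Fin N) ℝ,
      (P.PosDef ∧ P = riccatiMap A B Q R P) ∧
      (∀ P' : Matrix (Fin N) (Fin N) ℝ,
        P'.PosDef → P' = riccatiMap A B Q R P' → P' = P) ∧
      ∀ Pseq : ℕ → Matrix (Fin N) (Fin N) ℝ,
        (Pseq 0).PosDef →
        (∀ k, Pseq (k + 1) = riccatiMap A B Q R (Pseq k)) →
          (∀ k, (Pseq k).PosDef) ∧
          Tendsto Pseq atTop (𝓝 P) ∧
          riccatiRate A Q P (Pseq 0) < 1 ∧
          ∀ k : ℕ, matSpectralNorm (P - Pseq k) ≤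
            (Real.exp (riccatiRate A Q P (Pseq 0) ^ k * thomsonDist P (Pseq 0)) - 1) *
              matSpectralNorm P := by
  obtain ⟨P, hP, hfix⟩ := exists_posDef_eq_riccatiMap A B hQ hR hAB
  refine ⟨P, ⟨hP, hfix⟩, fun P' hP' hfix' => ?_, fun Pseq hP₀ hrec => ⟨?_, ?_, ?_, ?_⟩⟩
  -- The constant sequence `P'` is a Riccati orbit, so it converges to `P`.
  · exact tendsto_nhds_unique tendsto_const_nhds
      (tendsto_riccatiIterate (Y := fun _ => P') hQ hR hP hfix hP' fun _ => hfix')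
  · exact riccatiIterate_posDef hQ hR hP₀ hrec
  · exact tendsto_riccatiIterate hQ hR hP hfix hP₀ hrec
  · exact riccatiRate_lt_one A hQ hP (Pseq 0)
  · exact matSpectralNorm_sub_riccatiIterate_le hQ hR hP hfix hP₀ hrec
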